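/- For a finite group $G$ let $\rho(G)=\prod_{x\in G} o(x)$, where $o(x)$ is the order of the element $x$, and let $\Omega_\rho(G)=\Omega(\rho(G))$, where $\Omega(n)$ is the number of prime factors of the positive integer $n$, counted with multiplicity. Let $A_5$ be the alternating group of degree $5$. Then $\Omega_\rho(A_5)=59$, and for every group $G$ of order $60$ one has $\Omega_\rho(A_5)\le\Omega_\rho(G)$. Moreover, for such $G$, $\Omega_\rho(G)=59$ if and only if $G\cong A_5$. -/

import Mathlib

/-- The product `ρ(G) = ∏_{x ∈ G} o(x)` of the orders of all elements of a finite group. -/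
noncomputable def rho (G : Type*) [Group G] [Fintype G] : ℕ :=
  ∏ x : G, orderOf x

/-- `Ω_ρ(G) = Ω(ρ(G))`, the number of prime factors of `ρ(G)` counted with multiplicity. -/
noncomputable def omegaRho (G : Type*) [Group G] [Fintype G] : ℕ :=
  ArithmeticFunction.cardFactors (rho G)

/-! ### The lower bound and its equality case. -/

section OmegaRho

variable {G : Type*} [Group G] [Fintype G]

/-! Every nonidentity element contributes at least 1 to the sum, so the minimum |G| - 1 is attained
exactly when all of them have prime order, as in A₅. If |G| = 60, this forces centralizers of
nonidentity elements to have order 4, 3 or 5, and the class equation leaves 15 involutions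
(`card_involutions`). They split into threes among five Sylow 2-subgroups, on which G acts
faithfully; the image has index 2 in S₅, hence is A₅. -/

theorem omegaRho_eq_sum : omegaRho G = ∑ x : G, ArithmeticFunction.cardFactors (orderOf x) := by
  classical
  unfold omegaRho rho
  induction (Finset.univ : Finset G) using Finset.induction_on with
  | empty => simp
  | insert a s ha ih =>
    rw [Finset.prod_insert ha, Finset.sum_insert ha, ArithmeticFunction.cardFactors_mul, ih]
    · exact (orderOf_pos a).ne'
    · exact Finset.prod_ne_zero_iff.mpr fun x _ => (orderOf_pos x).ne'

theorem omegaRho_congr {H : Type*} [Group H] [Fintype H] (e : G ≃* H) :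
    omegaRho G = omegaRho H := by
  rw [omegaRho_eq_sum, omegaRho_eq_sum]
  exact Fintype.sum_equiv e.toEquiv _ _ fun x => by simp

theorem one_le_cardFactors_orderOf {x : G} (hx : x ≠ 1) :
    1 ≤ ArithmeticFunction.cardFactors (orderOf x) := by
  rw [Nat.one_le_iff_ne_zero, Ne, ArithmeticFunction.cardFactors_eq_zero_iff_eq_zero_or_one]
  rintro (h | h)
  · exact (orderOf_pos x).ne' h
  · exact hx (orderOf_eq_one_iff.mp h)

theorem sum_ite_ne_one [DecidableEq G] :
    ∑ x : G, (if x = 1 then 0 else 1) = Fintype.card G - 1 := by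
  rw [← Finset.card_univ, ← Finset.card_erase_of_mem (Finset.mem_univ (1 : G)),
    ← Finset.filter_ne' Finset.univ (1 : G), Finset.card_filter]
  exact Finset.sum_congr rfl fun x _ => by split_ifs <;> simp_all

theorem ite_ne_one_le_cardFactors [DecidableEq G] (x : G) :
    (if x = 1 then 0 else 1) ≤ ArithmeticFunction.cardFactors (orderOf x) := by
  split_ifs with h
  · exact Nat.zero_le _
  · exact one_le_cardFactors_orderOf h

theorem card_sub_one_le_omegaRho : Fintype.card G - 1 ≤ omegaRho G := by
  classical
  rw [omegaRho_eq_sum, ← sum_ite_ne_one]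
  exact Finset.sum_le_sum fun x _ => ite_ne_one_le_cardFactors x

theorem omegaRho_eq_card_sub_one_iff :
    omegaRho G = Fintype.card G - 1 ↔ ∀ x : G, x ≠ 1 → (orderOf x).Prime := by
  classical
  rw [omegaRho_eq_sum, ← sum_ite_ne_one, eq_comm,
    Finset.sum_eq_sum_iff_of_le fun x _ => ite_ne_one_le_cardFactors x]
  refine forall_congr' fun x => ?_
  by_cases hx : x = 1
  · simp [hx]
  · simp [hx, eq_comm (a := 1), ArithmeticFunction.cardFactors_eq_one_iff_prime]

end OmegaRho

/-! ### Element orders in A₅. -/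

theorem alternatingGroup_five_pow_eq_one :
    ∀ x : alternatingGroup (Fin 5), x ^ 2 = 1 ∨ x ^ 3 = 1 ∨ x ^ 5 = 1 := by
  decide +kernel

theorem prime_orderOf_alternatingGroup_five (x : alternatingGroup (Fin 5)) (hx : x ≠ 1) :
    (orderOf x).Prime := by
  have key : ∀ p : ℕ, p.Prime → x ^ p = 1 → (orderOf x).Prime := fun p hp h => by
    have := Fact.mk hp
    rwa [orderOf_eq_prime h hx]
  rcases alternatingGroup_five_pow_eq_one x with h | h | h
  · exact key 2 Nat.prime_two h
  · exact key 3 Nat.prime_three h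
  · exact key 5 Nat.prime_five h

theorem card_alternatingGroup_five : Fintype.card (alternatingGroup (Fin 5)) = 60 := by
  rw [card_alternatingGroup]; rfl

/-! ### Groups whose nonidentity elements have prime order. -/

section PrimeOrders

open Subgroup

variable {G : Type*} [Group G]

/-- Two distinct primes would give the product x * y a composite order. -/
theorem orderOf_eq_of_commute (hp : ∀ x : G, x ≠ 1 → (orderOf x).Prime) {x y : G}
    (hx : x ≠ 1) (hy : y ≠ 1) (h : Commute x y) : orderOf y = orderOf x := by
  by_contra hne
  have hc : (orderOf x).Coprime (orderOf y) :=
    (Nat.coprime_primes (hp x hx) (hp y hy)).mpr (Ne.symm hne)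
  have ho := h.orderOf_mul_eq_mul_orderOf_of_coprime hc
  have hxy : x * y ≠ 1 := fun h1 => by
    rw [h1, orderOf_one] at ho
    exact (hp x hx).one_lt.ne' (Nat.eq_one_of_mul_eq_one_right ho.symm)
  exact Nat.not_prime_mul (hp x hx).ne_one (hp y hy).ne_one (ho ▸ hp _ hxy)

theorem isPGroup_centralizer (hp : ∀ x : G, x ≠ 1 → (orderOf x).Prime) {x : G} (hx : x ≠ 1) :
    IsPGroup (orderOf x) (centralizer {x} : Subgroup G) := by
  intro y
  by_cases hy : (y : G) = 1
  · exact ⟨0, by ext; simp [hy]⟩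
  · refine ⟨1, ?_⟩
    have h : Commute x (y : G) := (mem_centralizer_singleton_iff.mp y.2).symm
    ext
    rw [pow_one, ← orderOf_eq_of_commute hp hx hy h, coe_pow, pow_orderOf_eq_one, coe_one]

variable [Fintype G]

theorem card_conjClass_mul_card_centralizer (x : G) :
    Nat.card (ConjClasses.mk x).carrier * Nat.card (centralizer {x} : Subgroup G) =
      Nat.card G := by
  classical
  rw [nat_card_centralizer_nat_card_stabilizer, ← ConjAct.orbit_eq_carrier_conjClasses,
    Nat.card_eq_fintype_card, Nat.card_eq_fintype_card,
    MulAction.card_orbit_mul_card_stabilizer_eq_card_group, ConjAct.card,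
    Nat.card_eq_fintype_card]

/-- Order is conjugation invariant, so the set is a union of classes, all of size m. -/
theorem dvd_card_orderOf_eq [DecidableEq G] {n m : ℕ}
    (h : ∀ x : G, orderOf x = n → Nat.card (ConjClasses.mk x).carrier = m) :
    m ∣ (Finset.univ.filter fun x : G => orderOf x = n).card := by
  classical
  rw [Finset.card_eq_sum_card_image ConjClasses.mk]
  refine Finset.dvd_sum fun c hc => ?_
  obtain ⟨x, hx, rfl⟩ := Finset.mem_image.mp hc
  have hx' : orderOf x = n := by simpa using hx
  rw [← h x hx', Nat.card_eq_card_toFinset]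
  refine dvd_of_eq (congrArg Finset.card ?_)
  ext y
  simp only [Set.mem_toFinset, ConjClasses.mem_carrier_iff_mk_eq, Finset.mem_filter,
    Finset.mem_univ, true_and]
  refine ⟨fun hy => ⟨?_, hy⟩, fun hy => hy.2⟩
  obtain ⟨c, rfl⟩ := isConj_iff.mp (ConjClasses.mk_eq_mk_iff_isConj.mp hy).symm
  rw [← hx']
  exact orderOf_injective (MulAut.conj c).toMonoidHom (MulAut.conj c).injective x

/-! ### Order 60: centralizers, Sylow 2-subgroups and the embedding in S₅. -/

section OrderSixty

theorem card_sylow_two (hG : Fintype.card G = 60)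
    (P : Sylow 2 G) : Nat.card P = 4 := by
  have h : (60 : ℕ).factorization 2 = 2 := by
    rw [show (60 : ℕ) = 2 ^ 2 * 15 by norm_num,
      Nat.factorization_mul (by norm_num) (by norm_num), Nat.Prime.factorization_pow Nat.prime_two,
      Finsupp.add_apply, Finsupp.single_eq_same, Nat.factorization_eq_zero_of_not_dvd (by norm_num)]
  rw [P.card_eq_multiplicity, Nat.card_eq_fintype_card, hG, h]
  norm_num

theorem sylow_two_le_centralizer (hG : Fintype.card G = 60)
    {P : Sylow 2 G} {x : G} (hx : x ∈ P) :
    (P : Subgroup G) ≤ centralizer {x} := by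
  intro y hy
  have hc := IsPGroup.isMulCommutative_of_card_eq_prime_sq (p := 2) (G := P)
    (by rw [card_sylow_two hG P]; rfl)
  rw [mem_centralizer_singleton_iff]
  exact congrArg Subtype.val (hc.is_comm.comm (⟨y, hy⟩ : P) ⟨x, hx⟩)

theorem card_sixty_orderOf (hG : Fintype.card G = 60)
    {x : G} (hx : (orderOf x).Prime) :
    orderOf x = 2 ∨ orderOf x = 3 ∨ orderOf x = 5 := by
  have h : orderOf x ∣ 60 := hG ▸ orderOf_dvd_card
  rw [show (60 : ℕ) = 2 ^ 2 * (3 * 5) by norm_num, hx.dvd_mul, hx.dvd_mul] at h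
  rcases h with h | h | h
  · exact .inl ((Nat.prime_dvd_prime_iff_eq hx Nat.prime_two).mp (hx.dvd_of_dvd_pow h))
  · exact .inr (.inl ((Nat.prime_dvd_prime_iff_eq hx Nat.prime_three).mp h))
  · exact .inr (.inr ((Nat.prime_dvd_prime_iff_eq hx Nat.prime_five).mp h))

theorem card_centralizer_eq_pow (hG : Fintype.card G = 60)
    (hp : ∀ x : G, x ≠ 1 → (orderOf x).Prime)
    {x : G} (hx : x ≠ 1) :
    ∃ k, Nat.card (centralizer {x} : Subgroup G) = orderOf x ^ k ∧ k ≠ 0 ∧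
      orderOf x ^ k ∣ 60 := by
  have := Fact.mk (hp x hx)
  obtain ⟨k, hk⟩ := IsPGroup.iff_card.mp (isPGroup_centralizer hp hx)
  refine ⟨k, hk, ?_, ?_⟩
  · rintro rfl
    have h1 := card_eq_one.mp (hk.trans (pow_zero _))
    have hm : x ∈ (centralizer {x} : Subgroup G) := mem_centralizer_singleton_iff.mpr rfl
    rw [h1, mem_bot] at hm
    exact hx hm
  · rw [← hk, ← hG, ← Nat.card_eq_fintype_card]
    exact card_subgroup_dvd_card _

theorem card_centralizer_of_orderOf_two (hG : Fintype.card G = 60)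
    (hp : ∀ x : G, x ≠ 1 → (orderOf x).Prime)
    {x : G} (hx : orderOf x = 2) :
    Nat.card (centralizer {x} : Subgroup G) = 4 := by
  have hx1 : x ≠ 1 := by rintro rfl; simp at hx
  obtain ⟨k, hk, -, hd⟩ := card_centralizer_eq_pow hG hp hx1
  rw [hx] at hk hd
  have hz : IsPGroup 2 (zpowers x) :=
    IsPGroup.of_card (n := 1) (by rw [Nat.card_zpowers, hx, pow_one])
  obtain ⟨P, hP⟩ := hz.exists_le_sylow
  have h4 := card_dvd_of_le (sylow_two_le_centralizer hG (hP (mem_zpowers x)))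
  rw [show Nat.card (P : Subgroup G) = 4 from card_sylow_two hG P] at h4
  have hk2 : k ≤ 2 := by
    by_contra! h
    exact absurd ((pow_dvd_pow 2 h).trans hd) (by norm_num)
  rw [hk] at h4 ⊢
  interval_cases k <;> omega

theorem card_centralizer_of_orderOf_ne_two (hG : Fintype.card G = 60)
    (hp : ∀ x : G, x ≠ 1 → (orderOf x).Prime)
    {x : G} (hx1 : x ≠ 1) (hx : orderOf x ≠ 2) :
    Nat.card (centralizer {x} : Subgroup G) = orderOf x := by
  obtain ⟨k, hk, hk0, hd⟩ := card_centralizer_eq_pow hG hp hx1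
  have hk1 : k ≤ 1 := by
    by_contra! h
    have h2 := (pow_dvd_pow (orderOf x) h).trans hd
    rcases card_sixty_orderOf hG (hp x hx1) with h3 | h3 | h3
    · exact hx h3
    -- Neither 9 nor 25 divides 60.
    all_goals rw [h3] at h2; revert h2; norm_num
  rw [hk, show k = 1 by omega, pow_one]

theorem card_centralizer_le_five (hG : Fintype.card G = 60)
    (hp : ∀ x : G, x ≠ 1 → (orderOf x).Prime)
    {x : G} (hx1 : x ≠ 1) :
    Nat.card (centralizer {x} : Subgroup G) ≤ 5 := by
  by_cases h2 : orderOf x = 2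
  · rw [card_centralizer_of_orderOf_two hG hp h2]; norm_num
  · rw [card_centralizer_of_orderOf_ne_two hG hp hx1 h2]
    rcases card_sixty_orderOf hG (hp x hx1) with h | h | h <;> omega

/-- The involutions form a single conjugacy class, by the class equation `1 + 15 + 20 + 12 + 12`. -/
theorem card_involutions [DecidableEq G] (hG : Fintype.card G = 60)
    (hp : ∀ x : G, x ≠ 1 → (orderOf x).Prime) :
    (Finset.univ.filter fun x : G => orderOf x = 2).card = 15 := by
  have hcl : ∀ x : G, Nat.card (ConjClasses.mk x).carrier *
      Nat.card (centralizer {x} : Subgroup G) = 60 := fun x => by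
    rw [card_conjClass_mul_card_centralizer, Nat.card_eq_fintype_card, hG]
  have h2 : 15 ∣ (Finset.univ.filter fun x : G => orderOf x = 2).card :=
    dvd_card_orderOf_eq fun x hx => by
      have := hcl x
      rw [card_centralizer_of_orderOf_two hG hp hx] at this
      omega
  have h3 : 20 ∣ (Finset.univ.filter fun x : G => orderOf x = 3).card :=
    dvd_card_orderOf_eq fun x hx => by
      have := hcl x
      rw [card_centralizer_of_orderOf_ne_two hG hp (by rintro rfl; simp at hx) (by omega),
        hx] at this
      omega
  have h5 : 12 ∣ (Finset.univ.filter fun x : G => orderOf x = 5).card :=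
    dvd_card_orderOf_eq fun x hx => by
      have := hcl x
      rw [card_centralizer_of_orderOf_ne_two hG hp (by rintro rfl; simp at hx) (by omega),
        hx] at this
      omega
  have pos : ∀ p : ℕ, p.Prime → p ∣ 60 →
      0 < (Finset.univ.filter fun x : G => orderOf x = p).card := fun p hpp hd => by
    have := Fact.mk hpp
    obtain ⟨x, hx⟩ := exists_prime_orderOf_dvd_card (G := G) p (hG ▸ hd)
    exact Finset.card_pos.mpr ⟨x, by simp [hx]⟩
  have p2 := pos 2 Nat.prime_two (by norm_num)
  have p3 := pos 3 Nat.prime_three (by norm_num)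
  have p5 := pos 5 Nat.prime_five (by norm_num)
  have hsum : (Finset.univ : Finset G).card = ∑ n ∈ ({1, 2, 3, 5} : Finset ℕ),
      (Finset.univ.filter fun x : G => orderOf x = n).card := by
    refine Finset.card_eq_sum_card_fiberwise fun x _ => ?_
    by_cases hx : x = 1
    · simp [hx]
    · rcases card_sixty_orderOf hG (hp x hx) with h | h | h <;> simp [h]
  have h1 : (Finset.univ.filter fun x : G => orderOf x = 1).card = 1 := by
    simp [orderOf_eq_one_iff, Finset.filter_eq']
  rw [Finset.card_univ, hG] at hsum
  -- The filter on order 1 must keep the shape it has in `h1`. Then 15a + 20b + 12c = 59 forces (a,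
  -- b, c) = (1, 1, 2).
  simp [-orderOf_eq_one_iff] at hsum
  omega

/-- The Sylow `2`-subgroups are the centralizers of the involutions. -/
theorem sylow_two_eq_centralizer (hG : Fintype.card G = 60)
    (hp : ∀ x : G, x ≠ 1 → (orderOf x).Prime)
    {P : Sylow 2 G} {x : G} (hx : orderOf x = 2) (hxP : x ∈ P) :
    (P : Subgroup G) = centralizer {x} :=
  eq_of_le_of_card_ge (sylow_two_le_centralizer hG hxP) <| by
    rw [card_centralizer_of_orderOf_two hG hp hx]
    exact (card_sylow_two hG P).ge

/-- An involution lies in just one Sylow 2-subgroup, its centralizer, and each such subgroup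
contains three. -/
theorem card_sylow_two_eq_five (hG : Fintype.card G = 60)
    (hp : ∀ x : G, x ≠ 1 → (orderOf x).Prime) :
    Nat.card (Sylow 2 G) = 5 := by
  classical
  have hex : ∀ x : G, ∃ P : Sylow 2 G, orderOf x = 2 → x ∈ P := fun x => by
    by_cases hx : orderOf x = 2
    · have hz : IsPGroup 2 (zpowers x) :=
        IsPGroup.of_card (n := 1) (by rw [Nat.card_zpowers, hx, pow_one])
      obtain ⟨P, hP⟩ := hz.exists_le_sylow
      exact ⟨P, fun _ => hP (mem_zpowers x)⟩
    · exact ⟨default, fun h => absurd h hx⟩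
  choose f hf using hex
  have := Fintype.ofFinite (Sylow 2 G)
  have hsum := Finset.card_eq_sum_card_fiberwise (f := f)
    (s := Finset.univ.filter fun x : G => orderOf x = 2) (t := Finset.univ) (by simp)
  have hfib : ∀ P : Sylow 2 G,
      ((Finset.univ.filter fun x : G => orderOf x = 2).filter fun x => f x = P).card = 3 := by
    intro P
    have heq : (Finset.univ.filter fun x : G => orderOf x = 2).filter (fun x => f x = P) =
        (Finset.univ.filter fun x : G => x ∈ P).erase 1 := by
      ext x
      simp only [Finset.mem_filter, Finset.mem_univ, true_and, Finset.mem_erase]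
      constructor
      · rintro ⟨hx, rfl⟩
        exact ⟨by rintro rfl; simp at hx, hf x hx⟩
      · rintro ⟨hx1, hxP⟩
        have hx : orderOf x = 2 := by
          obtain ⟨k, hk⟩ := IsPGroup.iff_orderOf.mp P.isPGroup' ⟨x, hxP⟩
          rw [orderOf_mk] at hk
          have hpr := hp x hx1
          rw [hk] at hpr
          rw [hk, hpr.eq_one_of_pow, pow_one]
        exact ⟨hx, Sylow.ext ((sylow_two_eq_centralizer hG hp hx (hf x hx)).trans
          (sylow_two_eq_centralizer hG hp hx hxP).symm)⟩
    rw [heq, Finset.card_erase_of_mem (by simp [one_mem]), ← Fintype.card_subtype,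
      ← Nat.card_eq_fintype_card, show Nat.card {x // x ∈ P} = 4 from card_sylow_two hG P]
  rw [card_involutions hG hp, Finset.sum_congr rfl fun P _ => hfib P, Finset.sum_const,
    Finset.card_univ, smul_eq_mul, ← Nat.card_eq_fintype_card] at hsum
  omega

/-- A nontrivial kernel would contain 1 and a class of size at least 60 / 5 = 12, yet lie in a point
stabilizer of order 12. -/
theorem toPermHom_sylow_two_injective (hG : Fintype.card G = 60)
    (hp : ∀ x : G, x ≠ 1 → (orderOf x).Prime) :
    Function.Injective (MulAction.toPermHom G (Sylow 2 G)) := by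
  rw [← MonoidHom.ker_eq_bot_iff, eq_bot_iff]
  intro x hx
  by_contra hx1
  rw [mem_bot] at hx1
  set K := (MulAction.toPermHom G (Sylow 2 G)).ker
  obtain ⟨P⟩ : Nonempty (Sylow 2 G) := inferInstance
  have hstab : Nat.card (MulAction.stabilizer G P) = 12 := by
    have h := (MulAction.stabilizer G P).card_mul_index
    rw [MulAction.index_stabilizer_of_transitive, card_sylow_two_eq_five hG hp,
      Nat.card_eq_fintype_card (α := G), hG] at h
    omega
  have hKle : K ≤ MulAction.stabilizer G P := fun g hg => by
    have := MonoidHom.mem_ker.mp hg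
    exact DFunLike.congr_fun this P
  have hK12 : Nat.card K ≤ 12 := hstab ▸ card_le_of_le hKle
  have hcl := card_conjClass_mul_card_centralizer x
  rw [Nat.card_eq_fintype_card (α := G), hG] at hcl
  have h5 := card_centralizer_le_five hG hp hx1
  have h12 : 12 ≤ Nat.card (ConjClasses.mk x).carrier := by nlinarith
  have hlt : (ConjClasses.mk x).carrier.ncard < (K : Set G).ncard := by
    refine Set.ncard_lt_ncard ⟨fun y hy => ?_, fun h => ?_⟩ (Set.toFinite _)
    · rw [ConjClasses.mem_carrier_iff_mk_eq, ConjClasses.mk_eq_mk_iff_isConj] at hy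
      obtain ⟨c, rfl⟩ := isConj_iff.mp hy.symm
      exact (inferInstance : K.Normal).conj_mem x hx c
    · have h1 := h (one_mem K)
      rw [ConjClasses.mem_carrier_iff_mk_eq, ConjClasses.mk_eq_mk_iff_isConj] at h1
      exact hx1 (isConj_one_right.mp h1)
  rw [← Nat.card_coe_set_eq, ← Nat.card_coe_set_eq] at hlt
  exact absurd (h12.trans_lt hlt) (not_lt.mpr hK12)

theorem nonempty_mulEquiv_alternatingGroup_five (hG : Fintype.card G = 60)
    (hp : ∀ x : G, x ≠ 1 → (orderOf x).Prime) :
    Nonempty (G ≃* alternatingGroup (Fin 5)) := by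
  classical
  have := Fintype.ofFinite (Sylow 2 G)
  have h5 := card_sylow_two_eq_five hG hp
  let φ := MulAction.toPermHom G (Sylow 2 G)
  have e₁ : G ≃* φ.range := φ.ofInjective (toPermHom_sylow_two_injective hG hp)
  have hidx : φ.range.index = 2 := by
    have h := φ.range.card_mul_index
    rw [← Nat.card_congr e₁.toEquiv, Nat.card_eq_fintype_card (α := G), hG, Nat.card_perm, h5,
      show Nat.factorial 5 = 120 from rfl] at h
    omega
  have e₂ := MulEquiv.subgroupCongr (Equiv.Perm.eq_alternatingGroup_of_index_eq_two hidx)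
  have e₃ := (Fintype.equivFinOfCardEq (Nat.card_eq_fintype_card.symm.trans h5)).altCongrHom
  exact ⟨(e₁.trans e₂).trans e₃⟩

end OrderSixty

end PrimeOrders

theorem mainTheorem5 (G : Type*) [Group G] [Fintype G] (hG : Fintype.card G = 60) :
    omegaRho (alternatingGroup (Fin 5)) = 59 ∧
      omegaRho (alternatingGroup (Fin 5)) ≤ omegaRho G ∧
      (omegaRho G = 59 ↔ Nonempty (G ≃* alternatingGroup (Fin 5))) := by
  have hA : omegaRho (alternatingGroup (Fin 5)) = 59 := by
    rw [omegaRho_eq_card_sub_one_iff.mpr prime_orderOf_alternatingGroup_five,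
      card_alternatingGroup_five]
  have hle : 59 ≤ omegaRho G := by
    have h := card_sub_one_le_omegaRho (G := G)
    rwa [hG] at h
  refine ⟨hA, hA.trans_le hle, fun h => ?_, fun ⟨e⟩ => (omegaRho_congr e).trans hA⟩
  refine nonempty_mulEquiv_alternatingGroup_five hG (omegaRho_eq_card_sub_one_iff.mp ?_)
  rw [h, hG]
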